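/- Let $G=(V,E)$ be a finite simple undirected graph with $n=|V|$ vertices. For distinct $u,v\in V$ let the monophonic interval $I(u,v)$ be the set of all vertices lying on some induced (chordless) path between $u$ and $v$, and let $I(u,u)=\emptyset$. A set $X\subseteq V$ is m-convex if the induced subgraph $G[X]$ is connected (the empty set being allowed) and $I(u,v)\subseteq X$ for all $u,v\in X$; if $G$ is connected, the first condition follows from the second. A set $H\subseteq V$ is an m-halfspace if both $H$ and $V\setminus H$ are m-convex. Then there are a single algorithm and a polynomial $f$ such that, for every finite graph $G$ given by its adjacency matrix, the algorithm halts after at most $f(n)$ steps and decides correctly whether $V$ admits a proper $2$-partition into m-convex sets, that is, whether $V=A\cup B$ with $A,B$ nonempty, disjoint and m-convex. Moreover, such a partition exists if and only if there is an m-halfspace $H$ of $G$ with $\emptyset\subsetneq H\subsetneq V$. Here an algorithm is a program for a unit-cost random access machine with registers and arrays of natural numbers whose only arithmetic is addition and truncated subtraction (so that polynomial time agrees with Turing machine polynomial time). -/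

import Mathlib

namespace SimpleGraph

variable {V : Type*} (G : SimpleGraph V)

/-- The monophonic interval: for `u ≠ v`, the set of all vertices lying on some induced
(that is, chordless) path between `u` and `v`; and `I(u,u) = ∅`. -/
def mInterval (u v : V) : Set V :=
  {z | u ≠ v ∧ ∃ p : G.Walk u v, p.IsPath ∧ p.IsChordless ∧ z ∈ p.support}

/-- A vertex set `X` is monophonically convex if `G[X]` is connected (the empty graph being
allowed) and `I(u,v) ⊆ X` for all `u, v ∈ X`. If `G` is connected, the first condition follows
from the second. -/
def IsMConvex (X : Set V) : Prop :=
  (G.induce X).Preconnected ∧ ∀ u ∈ X, ∀ v ∈ X, G.mInterval u v ⊆ X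

/-- A monophonic halfspace: both `H` and its complement are m-convex. -/
def IsMHalfspace (H : Set V) : Prop :=
  G.IsMConvex H ∧ G.IsMConvex Hᶜ

/-- The vertex set admits a proper `2`-partition into m-convex sets. -/
def HasProperMConvexBipartition : Prop :=
  ∃ A B : Set V, A.Nonempty ∧ B.Nonempty ∧ Disjoint A B ∧ A ∪ B = Set.univ ∧
    G.IsMConvex A ∧ G.IsMConvex B

end SimpleGraph

/-! A random access machine with registers `r₀, r₁, …` and arrays `A₀, A₁, …`, all holding natural
numbers, programmed by structured programs. A program mentions only finitely many registers
and arrays. Every elementary instruction and every test costs one unit of time. The only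
arithmetic is addition and truncated subtraction, so that the bit length of the numbers
grows by at most one per step; unit-cost time on this machine is therefore polynomially
related to Turing machine time. -/
namespace RAM

/-- Contents of the registers and of the arrays. -/
structure State where
  reg : ℕ → ℕ
  arr : ℕ → ℕ → ℕ

/-- Elementary instructions; the arguments are fixed numbers written in the program. -/
inductive Op where
  /-- `r_i := c` -/
  | const (i c : ℕ)
  /-- `r_i := r_j` -/
  | move (i j : ℕ)
  /-- `r_i := r_j + r_k` -/
  | add (i j k : ℕ)
  /-- `r_i := max (r_j - r_k) 0` -/
  | sub (i j k : ℕ)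
  /-- `r_i := A_a[r_j]` -/
  | load (i a j : ℕ)
  /-- `A_a[r_i] := r_j` -/
  | store (a i j : ℕ)

/-- Write `x` into register `i`. -/
def State.setReg (s : State) (i x : ℕ) : State :=
  { s with reg := Function.update s.reg i x }

/-- Write `x` into cell `m` of array `a`. -/
def State.setArr (s : State) (a m x : ℕ) : State :=
  { s with arr := Function.update s.arr a (Function.update (s.arr a) m x) }

/-- The effect of an elementary instruction. -/
def Op.apply : Op → State → State
  | const i c, s => s.setReg i c
  | move i j, s => s.setReg i (s.reg j)
  | add i j k, s => s.setReg i (s.reg j + s.reg k)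
  | sub i j k, s => s.setReg i (s.reg j - s.reg k)
  | load i a j, s => s.setReg i (s.arr a (s.reg j))
  | store a i j, s => s.setArr a (s.reg i) (s.reg j)

/-- Structured programs. -/
inductive Prog where
  /-- do nothing -/
  | skip
  /-- an elementary instruction -/
  | op (o : Op)
  /-- `p; q` -/
  | seq (p q : Prog)
  /-- `if r_i ≠ 0 then p else q` -/
  | ite (i : ℕ) (p q : Prog)
  /-- `while r_i ≠ 0 do p` -/
  | loop (i : ℕ) (p : Prog)

/-- `Exec p s t s'`: started in state `s`, the program `p` halts after exactly `t` units of time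
in state `s'`. -/
inductive Exec : Prog → State → ℕ → State → Prop where
  | skip (s : State) : Exec .skip s 1 s
  | op (o : Op) (s : State) : Exec (.op o) s 1 (o.apply s)
  | seq {p q : Prog} {s₁ s₂ s₃ : State} {t₁ t₂ : ℕ} (hp : Exec p s₁ t₁ s₂)
      (hq : Exec q s₂ t₂ s₃) : Exec (.seq p q) s₁ (t₁ + t₂) s₃
  | iteTrue {i : ℕ} {p q : Prog} {s s' : State} {t : ℕ} (hi : s.reg i ≠ 0)
      (hp : Exec p s t s') : Exec (.ite i p q) s (t + 1) s'
  | iteFalse {i : ℕ} {p q : Prog} {s s' : State} {t : ℕ} (hi : s.reg i = 0)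
      (hq : Exec q s t s') : Exec (.ite i p q) s (t + 1) s'
  | loopDone {i : ℕ} {p : Prog} {s : State} (hi : s.reg i = 0) : Exec (.loop i p) s 1 s
  | loopStep {i : ℕ} {p : Prog} {s₁ s₂ s₃ : State} {t₁ t₂ : ℕ} (hi : s₁.reg i ≠ 0)
      (hp : Exec p s₁ t₁ s₂) (hl : Exec (.loop i p) s₂ t₂ s₃) :
      Exec (.loop i p) s₁ (t₁ + t₂ + 1) s₃

/-- The machine is deterministic: running time and final state are determined by the program and
the initial state. -/
theorem Exec.unique {p : Prog} {s s₁ s₂ : State} {t₁ t₂ : ℕ} (h₁ : Exec p s t₁ s₁)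
    (h₂ : Exec p s t₂ s₂) : t₁ = t₂ ∧ s₁ = s₂ := by
  induction h₁ generalizing t₂ s₂ with
  | skip => cases h₂; exact ⟨rfl, rfl⟩
  | op => cases h₂; exact ⟨rfl, rfl⟩
  | seq _ _ ihp ihq =>
    cases h₂ with
    | seq hp hq =>
      obtain ⟨rfl, rfl⟩ := ihp hp
      obtain ⟨rfl, rfl⟩ := ihq hq
      exact ⟨rfl, rfl⟩
  | iteTrue hi _ ih =>
    cases h₂ with
    | iteTrue _ h => obtain ⟨rfl, rfl⟩ := ih h; exact ⟨rfl, rfl⟩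
    | iteFalse h0 _ => exact absurd h0 hi
  | iteFalse hi _ ih =>
    cases h₂ with
    | iteTrue h0 _ => exact absurd hi h0
    | iteFalse _ h => obtain ⟨rfl, rfl⟩ := ih h; exact ⟨rfl, rfl⟩
  | loopDone hi =>
    cases h₂ with
    | loopDone => exact ⟨rfl, rfl⟩
    | loopStep h0 _ _ => exact absurd hi h0
  | loopStep hi _ _ ihp ihl =>
    cases h₂ with
    | loopDone h0 => exact absurd h0 hi
    | loopStep _ hp hl =>
      obtain ⟨rfl, rfl⟩ := ihp hp
      obtain ⟨rfl, rfl⟩ := ihl hl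
      exact ⟨rfl, rfl⟩

open Classical in
/-- The input for a graph with vertices `0, …, n-1`: register `r₀` holds `n`, array `A₀` holds
the adjacency matrix row by row, and everything else is `0`. -/
noncomputable def graphInput {n : ℕ} (G : SimpleGraph (Fin n)) : State where
  reg i := if i = 0 then n else 0
  arr a m := if a = 0 ∧ ∃ u v : Fin n, G.Adj u v ∧ m = u * n + v then 1 else 0

/-- The property `P` of finite graphs can be decided in time polynomial in the number `n` of
vertices: a single program halts on every graph within `f(n)` steps, `f` a polynomial, and leaves
the answer (`1` for yes, `0` for no) in register `r₀`. -/
def DecidableInPolyTime (P : ∀ {n : ℕ}, SimpleGraph (Fin n) → Prop) : Prop :=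
  ∃ (prog : Prog) (f : Polynomial ℕ), ∀ (n : ℕ) (G : SimpleGraph (Fin n)),
    ∃ (t : ℕ) (s : State), Exec prog (graphInput G) t s ∧ t ≤ f.eval n ∧
      ((P G ∧ s.reg 0 = 1) ∨ (¬ P G ∧ s.reg 0 = 0))

end RAM

/-! A set and its complement are both m-convex exactly when each induces a connected subgraph and,
on each side, the vertices with a neighbour on the other side form a clique
(`hasProperMConvexBipartition_iff_cliqueBoundary`): a chordless path that leaves a set and returns
would need two boundary vertices that are distinct and nonadjacent.

If `G` is disconnected, such a partition exists iff there are exactly two components. If `G` is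
connected, some edge `ab` is cut, and for a fixed cut edge the connectivity of both sides follows
from the clique conditions. It remains to colour the vertices by `a` and `b`. The clique condition
involves four vertices, but `a` and `b` are themselves boundary vertices, so each boundary vertex
equals or is adjacent to the name of its side. Membership in the boundary can then be certified by a
single literal, and all constraints become 2-clauses (`forall_not_clash_iff`).

By the 2-SAT criterion (`exists_consistent_assignment`) solvability is a statement about the
transitive closure of the implications between literals. That closure, together with graph
reachability, is the least fixed point of one first-order operator of arity six. Such a fixed point
takes at most `n ^ 6` insertions, each found by evaluating a fixed first-order sentence in
polynomial time (`DecidableInPolyTime.of_fixedPoint`). -/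

namespace RAM

/-! ### Time-bounded correctness rules for programs. -/

/-- Started in `s`, the program `p` halts within `T` steps in a state satisfying `Q`. -/
def Runs (p : Prog) (s : State) (T : ℕ) (Q : State → Prop) : Prop :=
  ∃ t s', Exec p s t s' ∧ t ≤ T ∧ Q s'

namespace Runs

variable {p q : Prog} {s : State} {T T' : ℕ} {Q Q' : State → Prop}

theorem mono (h : Runs p s T Q) (hT : T ≤ T') (hQ : ∀ s', Q s' → Q' s') : Runs p s T' Q' := by
  obtain ⟨t, s', he, ht, hq⟩ := h
  exact ⟨t, s', he, ht.trans hT, hQ _ hq⟩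

theorem skip (h : Q s) : Runs .skip s 1 Q := ⟨1, s, .skip s, le_rfl, h⟩

theorem op {o : Op} (h : Q (o.apply s)) : Runs (.op o) s 1 Q := ⟨1, _, .op o s, le_rfl, h⟩

theorem seq (h : Runs p s T fun s' => Runs q s' T' Q) : Runs (.seq p q) s (T + T') Q := by
  obtain ⟨t, s', he, ht, t', s'', he', ht', hq⟩ := h
  exact ⟨_, _, .seq he he', by omega, hq⟩

theorem ite {i : ℕ} (hp : s.reg i ≠ 0 → Runs p s T Q) (hq : s.reg i = 0 → Runs q s T' Q) :
    Runs (.ite i p q) s (T + T' + 1) Q := by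
  by_cases h : s.reg i = 0
  · obtain ⟨t, s', he, ht, hQ⟩ := hq h
    exact ⟨_, _, .iteFalse h he, by omega, hQ⟩
  · obtain ⟨t, s', he, ht, hQ⟩ := hp h
    exact ⟨_, _, .iteTrue h he, by omega, hQ⟩

/-- A loop whose body decreases the measure `μ` while keeping the invariant `I`. -/
theorem loop {i : ℕ} (I : State → Prop) (μ : State → ℕ) (hs : I s)
    (hp : ∀ s, I s → s.reg i ≠ 0 → Runs p s T fun s' => I s' ∧ μ s' < μ s) :
    Runs (.loop i p) s (μ s * (T + 1) + 1) fun s' => I s' ∧ s'.reg i = 0 := by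
  induction hm : μ s using Nat.strong_induction_on generalizing s with
  | _ m ih =>
    by_cases h : s.reg i = 0
    · exact ⟨1, s, .loopDone h, by omega, hs, h⟩
    · obtain ⟨t, s', he, ht, hI, hlt⟩ := hp s hs h
      obtain ⟨t', s'', he', ht', hQ⟩ := ih _ (hm ▸ hlt) hI rfl
      refine ⟨_, _, .loopStep h he he', ?_, hQ⟩
      have : (μ s' + 1) * (T + 1) ≤ m * (T + 1) := Nat.mul_le_mul_right _ (hm ▸ hlt)
      rw [add_mul] at this
      omega

end Runs

/-! ### Evaluation of first-order formulas in polynomial time. -/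

/-- First-order formulas with `d` free variables (de Bruijn indices) over the arrays of a state:
`rel a l` says that the cell of array `a` indexed by the tuple `l` is not `0`. -/
inductive Formula : ℕ → Type where
  | rel {d : ℕ} (a : ℕ) (l : List (Fin d)) : Formula d
  | eq {d : ℕ} (i j : Fin d) : Formula d
  | not {d : ℕ} (φ : Formula d) : Formula d
  | and {d : ℕ} (φ ψ : Formula d) : Formula d
  | ex {d : ℕ} (φ : Formula (d + 1)) : Formula d

/-- The number with digits `l`, most significant first, in base `n`. -/
def encode (n : ℕ) (l : List ℕ) : ℕ := l.foldl (fun x v => x * n + v) 0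

namespace Formula

/-- Satisfaction over the universe `Fin n`, the relations being given by the arrays. -/
def Eval {n : ℕ} (A : ℕ → ℕ → ℕ) : {d : ℕ} → Formula d → (Fin d → Fin n) → Prop
  | _, rel a l, e => A a (encode n (l.map fun i => (e i : ℕ))) ≠ 0
  | _, eq i j, e => e i = e j
  | _, not φ, e => ¬ φ.Eval A e
  | _, and φ ψ, e => φ.Eval A e ∧ ψ.Eval A e
  | _, ex φ, e => ∃ v : Fin n, φ.Eval A (Matrix.vecCons v e)

/-- The register holding variable `i` of a formula with `d` free variables. -/
def varReg {d : ℕ} (i : Fin d) : ℕ := 6 + (d - 1 - i)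

/-- The program computing into register `3` the number with digits in the given registers and
base in register `0`. -/
def encodeProg : List ℕ → Prog
  | [] => .op (.const 3 0)
  | x :: l => .seq (encodeProg l) <| .seq (.op (.const 5 1)) <| .seq (.op (.move 4 3)) <|
      .seq (.op (.move 3 x)) <| .seq (.op (.move 2 0)) <|
      .loop 2 (.seq (.op (.add 3 3 4)) (.op (.sub 2 2 5)))

/-- A program evaluating a formula into register `1`, with the size of the universe in register
`0` and the values of the variables in the registers `varReg i`. -/
def prog : {d : ℕ} → Formula d → Prog
  | _, rel a l => .seq (encodeProg (l.map varReg).reverse) (.op (.load 1 a 3))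
  | _, eq i j => .seq (.op (.sub 1 (varReg i) (varReg j))) <|
      .seq (.op (.sub 2 (varReg j) (varReg i))) <| .seq (.op (.add 1 1 2))
      (.ite 1 (.op (.const 1 0)) (.op (.const 1 1)))
  | _, not φ => .seq φ.prog (.ite 1 (.op (.const 1 0)) (.op (.const 1 1)))
  | _, and φ ψ => .seq φ.prog (.ite 1 ψ.prog .skip)
  | d, ex φ => .seq (.op (.const 1 0)) <| .seq (.op (.const (6 + d) 0)) <|
      .seq (.op (.move 2 0)) <|
      .loop 2 <| .seq φ.prog <| .ite 1 (.op (.const 2 0)) <|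
        .seq (.op (.const 2 1)) <| .seq (.op (.add (6 + d) (6 + d) 2)) (.op (.sub 2 0 (6 + d)))

open Polynomial in
/-- A bound for the running time of `prog` in terms of the size of the universe. -/
noncomputable def cost : {d : ℕ} → Formula d → ℕ[X]
  | _, rel _ l => C l.length * (X * 3 + 5) + 2
  | _, eq _ _ => 6
  | _, not φ => φ.cost + 3
  | _, and φ ψ => φ.cost + ψ.cost + 2
  | _, ex φ => 3 + ((X + 1) * (φ.cost + 6) + 1)

/-- The registers hold the universe size and the values of the variables. -/
def Holds {n d : ℕ} (e : Fin d → Fin n) (s : State) : Prop :=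
  s.reg 0 = n ∧ ∀ i, s.reg (varReg i) = e i

/-- The registers of the variables bound by the leading existential quantifiers hold witnesses. -/
def Witnessed {n : ℕ} (s : State) : {d : ℕ} → Formula d → (Fin d → Fin n) → Prop
  | d, ex φ, e => ∃ v : Fin n, s.reg (6 + d) = v ∧ φ.Eval s.arr (Matrix.vecCons v e) ∧
      φ.Witnessed s (Matrix.vecCons v e)
  | _, rel _ _, _ => True
  | _, eq _ _, _ => True
  | _, not _, _ => True
  | _, and _ _, _ => True

/-- The head of `l` is the least significant digit, whence the reversals. Multiplication by the base
is repeated addition. -/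
theorem encodeProg_runs {n : ℕ} (l : List ℕ) (s : State) (h0 : s.reg 0 = n)
    (hl : ∀ x ∈ l, 6 ≤ x) :
    Runs (encodeProg l) s (l.length * (n * 3 + 5) + 1) fun s' =>
      s'.reg 3 = encode n (l.reverse.map s.reg) ∧ s'.arr = s.arr ∧ s'.reg 0 = n ∧
        ∀ j, 6 ≤ j → s'.reg j = s.reg j := by
  induction l with
  | nil =>
    refine (Runs.op ?_).mono (by simp) fun _ h => h
    simp only [Op.apply, State.setReg]
    refine ⟨by simp [encode], trivial, by simpa using h0, fun j hj => ?_⟩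
    simp [show j ≠ 3 by omega]
  | cons x l ih =>
    have hx := hl x (by simp)
    refine (Runs.seq (T' := n * 3 + 5) ((ih fun y hy => hl y (by simp [hy])).mono le_rfl ?_)).mono
      (by simp only [List.length_cons]; ring_nf; omega) fun _ h => h
    rintro s₁ ⟨h3, ha, hn, hr⟩
    refine (Runs.seq (Runs.op (Runs.seq (Runs.op (Runs.seq (Runs.op (Runs.seq (Runs.op
      ((Runs.loop (T := 2)
        -- The accumulator plus the additions still due is constant.
        (fun s' => s'.reg 3 + s'.reg 2 * s₁.reg 3 = s₁.reg 3 * n + s₁.reg x ∧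
          s'.reg 4 = s₁.reg 3 ∧ s'.reg 5 = 1 ∧ s'.arr = s.arr ∧ s'.reg 0 = n ∧
          ∀ j, 6 ≤ j → s'.reg j = s.reg j)
        (fun s' => s'.reg 2) ?_ ?_).mono le_rfl ?_))))))))).mono (T' := n * 3 + 5) ?_ fun _ h => h
    · have e1 : ∀ j, 6 ≤ j → j ≠ 2 ∧ j ≠ 3 ∧ j ≠ 4 ∧ j ≠ 5 := by omega
      obtain ⟨x2, x3, x4, x5⟩ := e1 x hx
      simp only [Op.apply, State.setReg]
      refine ⟨?_, ?_, ?_, ha, ?_, fun j hj => ?_⟩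
      · simp [x4, x5, hn]; ring
      · simp
      · simp
      · simpa using hn
      · obtain ⟨j2, j3, j4, j5⟩ := e1 j hj
        simp [j2, j3, j4, j5, hr j hj]
    · rintro s' ⟨i1, i2, i3, i4, i5, i6⟩ hne
      refine Runs.seq (Runs.op (Runs.op ?_))
      simp only [Op.apply, State.setReg]
      refine ⟨⟨?_, ?_, ?_, i4, ?_, fun j hj => ?_⟩, ?_⟩
      · obtain ⟨k, hk⟩ := Nat.exists_eq_succ_of_ne_zero hne
        simp [i2, i3, hk] at i1 ⊢
        rw [← i1]; ring
      · simpa using i2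
      · simpa using i3
      · simpa using i5
      · simp [show j ≠ 2 by omega, show j ≠ 3 by omega, i6 j hj]
      · simp [i3]; omega
    · rintro s' ⟨⟨i1, i2, i3, i4, i5, i6⟩, h2⟩
      refine ⟨?_, i4, i5, i6⟩
      rw [h2] at i1
      simp only [zero_mul, add_zero] at i1
      rw [i1, h3, hr x hx]
      simp [encode]
    · simp [Op.apply, State.setReg, hn]; omega

theorem varReg_ge {d : ℕ} (i : Fin d) : 6 ≤ varReg i := by simp [varReg]

theorem varReg_lt {d : ℕ} (i : Fin d) : varReg i < 6 + d := by
  have := i.2; simp only [varReg]; omega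

/-- `varReg` counts from the outermost variable, so a new quantifier shifts the indices but moves no
register; its own variable gets register `6 + d`. -/
theorem Holds.vecCons {n d : ℕ} {e : Fin d → Fin n} {s : State} (h : Holds e s) {v : Fin n}
    (hv : s.reg (6 + d) = v) : Holds (Matrix.vecCons v e) s := by
  refine ⟨h.1, fun i => ?_⟩
  refine Fin.cases ?_ (fun j => ?_) i
  · simpa [varReg] using hv
  · have : varReg j.succ = varReg j := by simp [varReg]; omega
    rw [this, h.2 j]; rfl

theorem Holds.congr {n d : ℕ} {e : Fin d → Fin n} {s s' : State} (h : Holds e s)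
    (h0 : s'.reg 0 = s.reg 0) (hr : ∀ j, 6 ≤ j → j < 6 + d → s'.reg j = s.reg j) : Holds e s' :=
  ⟨h0.trans h.1, fun i => (hr _ (varReg_ge i) (varReg_lt i)).trans (h.2 i)⟩

theorem Witnessed.congr {n : ℕ} {s s' : State} {d : ℕ} {φ : Formula d} {e : Fin d → Fin n}
    (h : Witnessed s φ e) (ha : s'.arr = s.arr) (hr : ∀ j, 6 ≤ j → s'.reg j = s.reg j) :
    Witnessed s' φ e := by
  induction φ with
  | ex φ ih =>
    obtain ⟨v, h1, h2, h3⟩ := h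
    exact ⟨v, (hr _ (by omega)).trans h1, ha ▸ h2, ih h3⟩
  | _ => trivial

/-- A successful search zeroes its loop counter and leaves register `6 + d` alone, so the witness
can still be read off. The counter is recomputed in every round because evaluating the body
overwrites the low registers. -/
theorem prog_runs {n d : ℕ} (φ : Formula d) (e : Fin d → Fin n) (s : State) (h : Holds e s) :
    Runs φ.prog s (φ.cost.eval n) fun s' =>
      (s'.reg 1 ≠ 0 ↔ φ.Eval s.arr e) ∧ (s'.reg 1 ≠ 0 → φ.Witnessed s' e) ∧ s'.arr = s.arr ∧
        s'.reg 0 = n ∧ ∀ j, 6 ≤ j → j < 6 + d → s'.reg j = s.reg j := by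
  induction φ generalizing s with
  | rel a l =>
    refine (Runs.seq ((encodeProg_runs (l.map varReg).reverse s h.1 ?_).mono le_rfl
      fun s' hs' => Runs.op ?_)).mono (by simp [cost]) fun _ h => h
    · simp only [List.mem_reverse, List.mem_map]
      rintro _ ⟨i, -, rfl⟩
      exact varReg_ge i
    · obtain ⟨h3, ha, hn, hr⟩ := hs'
      simp only [Op.apply, State.setReg]
      refine ⟨?_, fun _ => trivial, ha, by simpa using hn, fun j hj _ => ?_⟩
      · have : (fun i => s.reg (varReg i)) = fun i => (e i : ℕ) := funext h.2
        simp [Eval, h3, ha, Function.comp_def, this]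
      · simp [show j ≠ 1 by omega, hr j hj]
  | eq i j =>
    have hi := h.2 i
    have hj := h.2 j
    have gi := varReg_ge i
    have gj := varReg_ge j
    refine (Runs.seq (T' := 5) (Runs.op (Runs.seq (T' := 4) (Runs.op (Runs.seq (T' := 3)
      (Runs.op (Runs.ite (fun h1 => Runs.op ?_) fun h1 => Runs.op ?_))))))).mono
      (by simp [cost]) fun _ h => h
    all_goals
      simp [Op.apply, State.setReg, show varReg i ≠ 1 by omega, show varReg j ≠ 1 by omega, hi,
        hj] at h1
      refine ⟨?_, fun _ => trivial, rfl, ?_, fun k hk _ => ?_⟩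
      · simp [Op.apply, State.setReg, Eval, Fin.ext_iff]; omega
      · simpa [Op.apply, State.setReg] using h.1
      · simp [Op.apply, State.setReg, show k ≠ 1 by omega, show k ≠ 2 by omega]
  | not φ ih =>
    refine (Runs.seq ((ih e s h).mono le_rfl fun s' hs' => Runs.ite (T := 1) (T' := 1)
      (fun h1 => Runs.op ?_) fun h1 => Runs.op ?_)).mono (by simp [cost]) fun _ h => h
    all_goals
      obtain ⟨h2, -, ha, hn, hr⟩ := hs'
      refine ⟨?_, fun _ => trivial, ha, ?_, fun k hk hk' => ?_⟩
      · simp [Op.apply, State.setReg, Eval, ← h2, h1]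
      · simpa [Op.apply, State.setReg] using hn
      · simp [Op.apply, State.setReg, show k ≠ 1 by omega, hr k hk hk']
  | and φ ψ ihφ ihψ =>
    refine (Runs.seq ((ihφ e s h).mono le_rfl fun s' hs' => Runs.ite
      (T := ψ.cost.eval n) (T' := 1) (fun h1 => ?_) fun h1 => Runs.skip ?_)).mono
      (by simp [cost]; omega) fun _ h => h
    all_goals obtain ⟨h2, -, ha, hn, hr⟩ := hs'
    · refine (ihψ e s' (h.congr (hn.trans h.1.symm) hr)).mono le_rfl ?_
      rintro s'' ⟨g1, -, ga, gn, gr⟩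
      refine ⟨?_, fun _ => trivial, ga.trans ha, gn, fun k hk hk' =>
        (gr k hk hk').trans (hr k hk hk')⟩
      rw [g1, ha, Eval, and_iff_right (h2.1 h1)]
    · refine ⟨?_, fun _ => trivial, ha, hn, hr⟩
      simp [h1, Eval] at h2 ⊢
      exact fun h => absurd h h2
  | @ex d φ ih =>
    -- Either all values below the current one have failed, or a witness has been found and the loop
    -- is about to stop.
    let I : State → Prop := fun s' => s'.arr = s.arr ∧ s'.reg 0 = n ∧
      (∀ j, 6 ≤ j → j < 6 + d → s'.reg j = s.reg j) ∧
      ((s'.reg 1 = 0 ∧ s'.reg 2 = n - s'.reg (6 + d) ∧ s'.reg (6 + d) ≤ n ∧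
        ∀ v : Fin n, (v : ℕ) < s'.reg (6 + d) → ¬ φ.Eval s.arr (Matrix.vecCons v e)) ∨
       (s'.reg 1 ≠ 0 ∧ s'.reg 2 = 0 ∧ (ex φ).Witnessed s' e))
    refine (Runs.seq (Runs.op (Runs.seq (Runs.op (Runs.seq (Runs.op
      ((Runs.loop (T := φ.cost.eval n + 5) I (fun s' => s'.reg 2) ?_ ?_).mono
        (T' := (n + 1) * (φ.cost.eval n + 6) + 1) ?_ ?_))))))).mono
      (by simp [cost]; omega) fun _ h => h
    · simp only [Op.apply, State.setReg, I]
      have e0 : 0 ≠ 6 + d := by omega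
      have e1 : 1 ≠ 6 + d := by omega
      have e2 : 6 + d ≠ 2 := by omega
      refine ⟨trivial, by simpa [e0] using h.1, fun j hj hj' => ?_, Or.inl ⟨?_, ?_, ?_, ?_⟩⟩
      · simp [show j ≠ 1 by omega, show j ≠ 2 by omega, show j ≠ 6 + d by omega]
      · simp [e1]
      · simp [e0, e2, h.1]
      · simp [e2]
      · simp [e2]
    · rintro s₁ ⟨i1, i2, i3, ⟨j1, j2, j3, j4⟩ | ⟨-, hz, -⟩⟩ hne
      swap
      · exact absurd hz hne
      have hlt : s₁.reg (6 + d) < n := by omega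
      have hH : Holds (Matrix.vecCons ⟨_, hlt⟩ e) s₁ := (h.congr (i2.trans h.1.symm) i3).vecCons rfl
      refine (Runs.seq (T' := 5) ((ih _ s₁ hH).mono le_rfl fun s₂ hs₂ =>
        Runs.ite (T := 1) (T' := 3) (fun h1 => Runs.op ?_) fun h1 => Runs.seq (T' := 2) (Runs.op
          (Runs.seq (Runs.op (Runs.op ?_))))))
      all_goals
        obtain ⟨h2, hw, ha, hn, hr⟩ := hs₂
        have hd : s₂.reg (6 + d) = s₁.reg (6 + d) := hr _ (by omega) (by omega)
      · refine ⟨⟨ha.trans i1, ?_, fun j hj hj' => ?_, Or.inr ⟨?_, ?_, ⟨_, hlt⟩, ?_, ?_, ?_⟩⟩, ?_⟩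
        · simpa [Op.apply, State.setReg] using hn
        · simp [Op.apply, State.setReg, show j ≠ 2 by omega]
          rw [hr j hj (by omega), i3 j hj hj']
        · simpa [Op.apply, State.setReg] using h1
        · simp [Op.apply, State.setReg]
        · simp [Op.apply, State.setReg, show 6 + d ≠ 2 by omega, hd]
        · simp only [Op.apply, State.setReg]
          rw [ha]; exact h2.1 h1
        · refine (hw h1).congr rfl fun j hj => ?_
          simp [Op.apply, State.setReg, show j ≠ 2 by omega]
        · simp [Op.apply, State.setReg]; omega
      · refine ⟨⟨ha.trans i1, ?_, fun j hj hj' => ?_, Or.inl ⟨?_, ?_, ?_, ?_⟩⟩, ?_⟩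
        · simpa [Op.apply, State.setReg, show 0 ≠ 6 + d by omega] using hn
        · simp [Op.apply, State.setReg, show j ≠ 2 by omega, show j ≠ 6 + d by omega]
          rw [hr j hj (by omega), i3 j hj hj']
        · simpa [Op.apply, State.setReg, show 1 ≠ 6 + d by omega] using h1
        · simp [Op.apply, State.setReg, show 6 + d ≠ 2 by omega, hn, show 0 ≠ 6 + d by omega]
        · simp [Op.apply, State.setReg, show 6 + d ≠ 2 by omega, hd]; omega
        · simp only [Op.apply, State.setReg]
          intro v hv
          simp [show 6 + d ≠ 2 by omega, hd] at hv
          rcases Nat.lt_or_eq_of_le hv with hv | hv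
          · exact j4 v hv
          · have : v = ⟨_, hlt⟩ := Fin.ext hv
            rw [this, ← i1]
            exact fun hE => (h2.2 hE) h1
        · simp [Op.apply, State.setReg, show 6 + d ≠ 2 by omega, hd, hn,
            show 0 ≠ 6 + d by omega]; omega
    · simp [Op.apply, State.setReg, h.1, show 0 ≠ 6 + d by omega]
    · rintro s' ⟨⟨i1, i2, i3, ⟨j1, j2, j3, j4⟩ | ⟨j1, -, j3⟩⟩, hz⟩
      · refine ⟨?_, fun h => absurd j1 h, i1, i2, i3⟩
        simp only [j1, ne_eq, not_true_eq_false, Eval, false_iff, not_exists]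
        exact fun v => j4 v (by omega)
      · refine ⟨⟨fun _ => ?_, fun _ => j1⟩, fun _ => j3, i1, i2, i3⟩
        obtain ⟨v, -, hv, -⟩ := j3
        exact ⟨v, i1 ▸ hv⟩

end Formula
end RAM

/-! ### Least fixed points of first-order operators. -/

namespace RAM

theorem encode_concat (n : ℕ) (l : List ℕ) (v : ℕ) :
    encode n (l.concat v) = encode n l * n + v := by
  simp [encode]

theorem encode_ofFn_injective (n k : ℕ) :
    Function.Injective fun e : Fin k → Fin n => encode n (List.ofFn fun i => (e i : ℕ)) := by
  induction k with
  | zero => exact fun _ _ _ => Subsingleton.elim _ _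
  | succ k ih =>
    intro e e' h
    simp only [List.ofFn_succ', encode_concat] at h
    have hn : 0 < n := (Nat.zero_le _).trans_lt (e (Fin.last k)).2
    have h1 := congrArg (· % n) h
    have h2 := congrArg (· / n) h
    simp only [Nat.mul_add_mod_self_right, Nat.mod_eq_of_lt (Fin.is_lt _)] at h1
    simp only [Nat.mul_comm _ n, Nat.mul_add_div hn, Nat.div_eq_of_lt (Fin.is_lt _),
      add_zero] at h2
    have h3 := ih h2
    funext i
    exact Fin.lastCases (Fin.ext h1) (fun j => congrFun h3 j) i

namespace Formula

/-- The existential closure. -/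
def exs : {k : ℕ} → Formula k → Formula 0
  | 0, φ => φ
  | _ + 1, φ => exs (ex φ)

theorem eval_exs {n k : ℕ} (A : ℕ → ℕ → ℕ) (φ : Formula k) (e₀ : Fin 0 → Fin n) :
    (exs φ).Eval A e₀ ↔ ∃ e : Fin k → Fin n, φ.Eval A e := by
  induction k with
  | zero => exact ⟨fun h => ⟨_, h⟩, fun ⟨e, h⟩ => Subsingleton.elim e e₀ ▸ h⟩
  | succ k ih =>
    rw [exs, ih]
    constructor
    · rintro ⟨e, v, h⟩; exact ⟨_, h⟩
    · rintro ⟨e, h⟩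
      refine ⟨Matrix.vecTail e, Matrix.vecHead e, ?_⟩
      rwa [Matrix.cons_head_tail]

theorem Witnessed.exists_holds {n k : ℕ} {s : State} {φ : Formula k} {e₀ : Fin 0 → Fin n}
    (h : (exs φ).Witnessed s e₀) (he : (exs φ).Eval s.arr e₀) (hn : s.reg 0 = n) :
    ∃ e : Fin k → Fin n, Holds e s ∧ φ.Eval s.arr e ∧ φ.Witnessed s e := by
  induction k with
  | zero => exact ⟨e₀, ⟨hn, fun i => i.elim0⟩, he, h⟩
  | succ k ih =>
    obtain ⟨e, h1, -, v, h2, h3, h4⟩ := ih h he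
    exact ⟨_, h1.vecCons h2, h3, h4⟩

/-- The atom saying that the tuple of all variables belongs to the array `a`. -/
def self (a k : ℕ) : Formula k := rel a (List.finRange k)

/-- The relation of arity `k` given by an array. -/
def tuples (n k : ℕ) (f : ℕ → ℕ) : Set (Fin k → Fin n) :=
  {e | f (encode n (List.ofFn fun i => (e i : ℕ))) ≠ 0}

theorem eval_self {n k a : ℕ} (A : ℕ → ℕ → ℕ) (e : Fin k → Fin n) :
    (self a k).Eval A e ↔ e ∈ tuples n k (A a) := by
  simp [self, Eval, tuples, List.ofFn_eq_map]

theorem tuples_update {n k : ℕ} (f : ℕ → ℕ) (e : Fin k → Fin n) :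
    tuples n k (Function.update f (encode n (List.ofFn fun i => (e i : ℕ))) 1) =
      insert e (tuples n k f) := by
  ext e'
  by_cases h : e' = e
  · simp [tuples, h]
  · simp [tuples, h, Function.update_of_ne ((encode_ofFn_injective n k).ne h)]

/-- `∃ x, φ x ∧ x ∉ A_a`. -/
def missing {k : ℕ} (a : ℕ) (φ : Formula k) : Formula 0 := exs (and φ (not (self a k)))

/-- A program adding tuples satisfying `φ` to the array `a` as long as there are any. -/
def fixProg {k : ℕ} (a : ℕ) (φ : Formula k) : Prog :=
  .seq (missing a φ).prog <| .loop 1 <|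
    .seq (encodeProg ((List.finRange k).map varReg).reverse) <|
      .seq (.op (.const 5 1)) <| .seq (.op (.store a 3 5)) (missing a φ).prog

open Polynomial in
/-- A bound for the running time of `fixProg`. -/
noncomputable def fixCost {k : ℕ} (a : ℕ) (φ : Formula k) : ℕ[X] :=
  (missing a φ).cost + (X ^ k * (C k * (X * 3 + 5) + (missing a φ).cost + 4) + 1)

/-- The set `L` of tuples is closed under `φ`, read as an operator on the array `a`. -/
def ClosedUnder {n k : ℕ} (a : ℕ) (φ : Formula k) (A : ℕ → ℕ → ℕ) (L : Set (Fin k → Fin n)) :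
    Prop :=
  ∀ A' : ℕ → ℕ → ℕ, (∀ b ≠ a, A' b = A b) → tuples n k (A' a) ⊆ L → ∀ e, φ.Eval A' e → e ∈ L

/-- Each round inserts a tuple not yet present, so there are at most `n ^ k` rounds. `ClosedUnder`
speaks of every stage contained in `L`, so an inserted tuple stays in `L` without any monotonicity
of `φ`. -/
theorem fixProg_runs {n k : ℕ} (a : ℕ) (φ : Formula k) (s : State) (h0 : s.reg 0 = n) :
    Runs (fixProg a φ) s ((fixCost a φ).eval n) fun s' =>
      s'.reg 0 = n ∧ (∀ b ≠ a, s'.arr b = s.arr b) ∧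
        (∀ e : Fin k → Fin n, φ.Eval s'.arr e → e ∈ tuples n k (s'.arr a)) ∧
        ∀ L : Set (Fin k → Fin n), ClosedUnder a φ s.arr L → tuples n k (s.arr a) ⊆ L →
          tuples n k (s'.arr a) ⊆ L := by
  let e₀ : Fin 0 → Fin n := Fin.elim0
  have holds₀ : ∀ s : State, s.reg 0 = n → Holds e₀ s := fun s hs => ⟨hs, fun i => i.elim0⟩
  let I : State → Prop := fun s' =>
    (s'.reg 1 ≠ 0 ↔ (missing a φ).Eval s'.arr e₀) ∧
    (s'.reg 1 ≠ 0 → (missing a φ).Witnessed s' e₀) ∧ s'.reg 0 = n ∧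
    (∀ b ≠ a, s'.arr b = s.arr b) ∧
    ∀ L : Set (Fin k → Fin n), ClosedUnder a φ s.arr L → tuples n k (s.arr a) ⊆ L →
      tuples n k (s'.arr a) ⊆ L
  refine (Runs.seq (((missing a φ).prog_runs e₀ s (holds₀ s h0)).mono le_rfl fun s₁ hs₁ =>
    (Runs.loop (T := k * (n * 3 + 5) + 1 + (1 + (1 + (missing a φ).cost.eval n))) I
      (fun s' => (tuples n k (s'.arr a))ᶜ.ncard) ?_ ?_).mono
      (T' := n ^ k * (k * (n * 3 + 5) + (missing a φ).cost.eval n + 4) + 1) ?_ ?_)).mono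
      (by simp [fixCost]) fun _ h => h
  · obtain ⟨h1, h2, h3, h4, -⟩ := hs₁
    rw [← h3] at h1
    exact ⟨h1, h2, h4, fun b _ => by rw [h3], fun L _ hL => by rwa [h3]⟩
  · rintro s₁ ⟨i1, i2, i3, i4, i5⟩ hne
    -- The nested searches have left the missing tuple in the variable registers.
    obtain ⟨e, he, hφ, -⟩ := (i2 hne).exists_holds (i1.1 hne) i3
    obtain ⟨hφ, he'⟩ := hφ
    rw [Eval, eval_self] at he'
    refine Runs.seq ((encodeProg_runs ((List.finRange k).map varReg).reverse s₁ i3 ?_).mono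
      (by simp) fun s₂ hs₂ => Runs.seq (Runs.op (Runs.seq (Runs.op
        (((missing a φ).prog_runs e₀ _ (holds₀ _ ?_)).mono le_rfl ?_)))))
    · simp only [List.mem_reverse, List.mem_map]
      rintro _ ⟨i, -, rfl⟩
      exact varReg_ge i
    · simpa [Op.apply, State.setReg, State.setArr] using hs₂.2.2.1
    · obtain ⟨h3, ha, hn, hr⟩ := hs₂
      have hreg : s₂.reg 3 = encode n (List.ofFn fun i => (e i : ℕ)) := by
        have : (fun i => s₁.reg (varReg i)) = fun i => (e i : ℕ) := funext he.2
        simp [h3, List.ofFn_eq_map, Function.comp_def, this]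
      rintro s₃ ⟨j1, j2, j3, j4, -⟩
      have harr : s₃.arr = Function.update s₁.arr a (Function.update (s₁.arr a)
          (encode n (List.ofFn fun i => (e i : ℕ))) 1) := by
        rw [j3]
        simp [Op.apply, State.setReg, State.setArr, hreg, ha]
      have htup : tuples n k (s₃.arr a) = insert e (tuples n k (s₁.arr a)) := by
        rw [harr, Function.update_self, tuples_update]
      rw [← j3] at j1
      refine ⟨⟨j1, j2, j4, fun b hb => ?_, fun L hL hs => ?_⟩, ?_⟩
      · rw [harr, Function.update_of_ne hb, i4 b hb]
      · rw [htup]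
        exact Set.insert_subset (hL _ i4 (i5 L hL hs) e hφ) (i5 L hL hs)
      · rw [htup]
        refine Set.ncard_lt_ncard ?_
        exact compl_lt_compl_iff_lt.2 (Set.ssubset_insert he')
  · refine Nat.add_le_add (Nat.mul_le_mul ?_ (by omega)) le_rfl
    refine (Set.ncard_le_card _).trans ?_
    simp
  · rintro s' ⟨⟨i1, -, i3, i4, i5⟩, hz⟩
    refine ⟨i3, i4, fun e he => ?_, i5⟩
    by_contra hmem
    refine i1.2 ?_ hz
    rw [missing, eval_exs]
    exact ⟨e, he, by rwa [Eval, eval_self]⟩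

end Formula

open Formula in
/-- A property of graphs is decidable in polynomial time if it is given by a first-order sentence
`ψ` about the adjacency relation and the least fixed point of a first-order operator `φ`. -/
theorem DecidableInPolyTime.of_fixedPoint {k : ℕ} (φ : Formula k) (ψ : Formula 0)
    {P : ∀ {n : ℕ}, SimpleGraph (Fin n) → Prop}
    (h : ∀ (n : ℕ) (G : SimpleGraph (Fin n)) (A : ℕ → ℕ → ℕ) (e₀ : Fin 0 → Fin n),
      A 0 = (graphInput G).arr 0 →
      (∀ e : Fin k → Fin n, φ.Eval A e → e ∈ tuples n k (A 1)) →
      (∀ L : Set (Fin k → Fin n), ClosedUnder 1 φ A L → tuples n k (A 1) ⊆ L) →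
      (ψ.Eval A e₀ ↔ P G)) :
    DecidableInPolyTime P := by
  refine ⟨.seq (fixProg 1 φ) (.seq ψ.prog (.ite 1 (.op (.const 0 1)) (.op (.const 0 0)))),
    fixCost 1 φ + (ψ.cost + 3), fun n G => ?_⟩
  suffices Runs (.seq (fixProg 1 φ) (.seq ψ.prog (.ite 1 (.op (.const 0 1)) (.op (.const 0 0)))))
      (graphInput G) ((fixCost 1 φ + (ψ.cost + 3)).eval n)
      fun s => (P G ∧ s.reg 0 = 1) ∨ (¬ P G ∧ s.reg 0 = 0) from this
  have h0 : (graphInput G).reg 0 = n := by simp [graphInput]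
  refine (Runs.seq ((fixProg_runs 1 φ _ h0).mono le_rfl fun s hs => Runs.seq
    ((ψ.prog_runs (n := n) Fin.elim0 s ⟨hs.1, fun i => i.elim0⟩).mono le_rfl fun s' hs' =>
      Runs.ite (T := 1) (T' := 1) (fun h1 => Runs.op ?_) fun h1 => Runs.op ?_))).mono
    (by simp) fun _ h => h
  all_goals
    have key := h n G s.arr Fin.elim0 (hs.2.1 0 zero_ne_one) hs.2.2.1 fun L hL =>
      hs.2.2.2 L (fun A' hA' => hL A' fun b hb => (hA' b hb).trans (hs.2.1 b hb).symm) <| by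
        -- Array `1` of the input is zero: the iteration starts from the empty relation.
        intro e he
        simp [tuples, graphInput] at he
    rw [← key, ← hs'.1]
    simp [h1, Op.apply, State.setReg]

end RAM

/-! ### The 2-SAT criterion. -/

/-- Solvability of 2-SAT: an implication relation on literals that is closed under contraposition
admits a consistent assignment respecting all implications unless some literal and its negation
imply each other. -/
theorem exists_consistent_assignment {V : Type*} [Finite V] (I : V × Bool → V × Bool → Prop)
    (hI : ∀ x s y t, I (x, s) (y, t) → I (y, !t) (x, !s))
    (h : ∀ x, ¬ (Relation.TransGen I (x, true) (x, false) ∧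
      Relation.TransGen I (x, false) (x, true))) :
    ∃ f : V → Bool, ∀ p q, I p q → f p.1 = p.2 → f q.1 = q.2 := by
  classical
  let R := Relation.ReflTransGen I
  have skew : ∀ p q, R p q → R (q.1, !q.2) (p.1, !p.2) := by
    intro p q hpq
    induction hpq with
    | refl => exact .refl
    | tail _ h1 ih => exact .head (hI _ _ _ _ h1) ih
  have trans_of : ∀ x s, R (x, s) (x, !s) → Relation.TransGen I (x, s) (x, !s) := by
    intro x s hR
    rcases Relation.reflTransGen_iff_eq_or_transGen.1 hR with h | h
    · cases s <;> simp at h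
    · exact h
  -- Consistent sets of literals closed under consequences; a maximal one will decide every
  -- variable.
  let good : Set (Set (V × Bool)) := {S | (∀ p q, p ∈ S → R p q → q ∈ S) ∧
    ∀ x s, (x, s) ∈ S → (x, !s) ∉ S}
  obtain ⟨S, hS⟩ := good.toFinite.exists_maximal ⟨∅, by simp [good]⟩
  have total : ∀ x, (x, true) ∈ S ∨ (x, false) ∈ S := by
    intro x
    by_contra hx
    rw [not_or] at hx
    obtain ⟨s, hs⟩ : ∃ s, ¬ R (x, s) (x, !s) := by
      by_contra hc
      push Not at hc
      exact h x ⟨trans_of x true (hc true), trans_of x false (hc false)⟩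
    have hxs : ∀ s, (x, s) ∉ S := by rintro (_ | _) <;> simp [hx]
    have hclosed := hS.prop.1
    have hcons := hS.prop.2
    -- If `x` is undecided, all consequences of `(x, s)` can be added. By contraposition, a conflict
    -- with `S` would put `(x, !s)` into `S`, and a conflict among the consequences would make `(x,
    -- s)` imply `(x, !s)`.
    refine hxs s (hS.le_of_ge (y := S ∪ {q | R (x, s) q}) ⟨?_, ?_⟩ Set.subset_union_left
      (Or.inr Relation.ReflTransGen.refl))
    · rintro p q (hp | hp) hpq
      · exact Or.inl (hclosed p q hp hpq)
      · exact Or.inr (Relation.ReflTransGen.trans hp hpq)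
    · rintro y t (hy | hy) (hy' | hy')
      · exact hcons y t hy hy'
      · have := skew _ _ hy'
        simp only [Bool.not_not] at this
        exact hxs _ (hclosed _ _ hy this)
      · exact hxs _ (hclosed _ _ hy' (skew _ _ hy))
      · have := skew _ _ hy'
        simp only [Bool.not_not] at this
        exact hs (Relation.ReflTransGen.trans hy this)
  have mem_iff : ∀ x s, decide ((x, true) ∈ S) = s ↔ (x, s) ∈ S := by
    have hcons := hS.prop.2
    rintro x (_ | _)
    · have := hcons x false
      have := total x
      simp only [decide_eq_false_iff_not]
      tauto
    · simp
  refine ⟨fun x => decide ((x, true) ∈ S), fun p q hpq hp => ?_⟩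
  rw [mem_iff] at hp ⊢
  exact hS.prop.1 p q hp (.single hpq)

/-! ### m-convex bipartitions and clique boundaries. -/

namespace SimpleGraph

variable {V : Type*} (G : SimpleGraph V)

/-- The vertices of `H` adjacent to the complement of `H` form a clique. -/
def CliqueBoundary (H : Set V) : Prop :=
  ∀ x ∈ H, ∀ x' ∉ H, G.Adj x x' → ∀ y ∈ H, ∀ y' ∉ H, G.Adj y y' → x = y ∨ G.Adj x y

variable {G}

/-- Two vertices joined by a walk with all vertices in `S` are joined by an induced path with all
vertices in `S`. -/
theorem Walk.exists_isChordless {S : Set V} {x y : V} (w : G.Walk x y)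
    (hw : ∀ v ∈ w.support, v ∈ S) :
    ∃ p : G.Walk x y, p.IsPath ∧ p.IsChordless ∧ ∀ v ∈ p.support, v ∈ S := by
  classical
  induction hl : w.length using Nat.strong_induction_on generalizing w with
  | _ m ih =>
    by_cases hp : w.IsPath
    · by_cases hc : w.IsChordless
      · exact ⟨w, hp, hc, hw⟩
      -- A chord joins positions at least two apart, so following it shortens the walk.
      · obtain ⟨i, j, hij, hj, hadj⟩ : ∃ i j, i + 1 < j ∧ j ≤ w.length ∧
            G.Adj (w.getVert i) (w.getVert j) := by
          rw [Walk.isChordless_iff_forall_mem_edges] at hc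
          push Not at hc
          obtain ⟨u', v', hu, hv, hadj, he⟩ := hc
          obtain ⟨i, rfl, hi⟩ := Walk.mem_support_iff_exists_getVert.1 hu
          obtain ⟨j, rfl, hj⟩ := Walk.mem_support_iff_exists_getVert.1 hv
          rw [Walk.mk_mem_edges_iff_exists] at he
          push Not at he
          have h1 : i ≠ j := fun h => hadj.ne (by rw [h])
          have h2 : j ≠ i + 1 := fun h => he i (by omega) (by rw [h])
          have h3 : i ≠ j + 1 := fun h => he j (by omega) (by rw [h, Sym2.eq_swap])
          rcases lt_or_gt_of_ne h1 with h | h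
          · exact ⟨i, j, by omega, hj, hadj⟩
          · exact ⟨j, i, by omega, hi, hadj.symm⟩
        refine ih _ ?_ ((w.take i).append (.cons hadj (w.drop j))) ?_ rfl
        · simp only [Walk.length_append, Walk.take_length, Walk.length_cons, Walk.drop_length]
          omega
        · intro v hv
          rw [Walk.mem_support_append_iff, Walk.support_cons, List.mem_cons] at hv
          rcases hv with hv | rfl | hv
          · exact hw _ ((w.isSubwalk_take i).support_subset hv)
          · exact hw _ (w.getVert_mem_support i)
          · exact hw _ ((w.isSubwalk_drop j).support_subset hv)
    · refine ih w.bypass.length ?_ w.bypass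
        (fun v hv => hw v (w.support_bypass_subset_support hv)) rfl
      refine hl ▸ lt_of_not_ge fun h => hp ?_
      rw [← w.bypass_eq_self_of_length_le_length_bypass h]
      exact w.bypass_isPath

/-- A path through a vertex outside `H` leaves `H` before it and returns after it. The two boundary
vertices, at positions `i` and `j + 1` with `i < k ≤ j`, are equal or adjacent, which a chordless
path forbids. -/
theorem CliqueBoundary.mInterval_subset {H : Set V} (hH : G.CliqueBoundary H) {u v : V}
    (hu : u ∈ H) (hv : v ∈ H) : G.mInterval u v ⊆ H := by
  rintro z ⟨-, p, hp, hc, hz⟩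
  by_contra hzH
  obtain ⟨k, rfl, hk⟩ := Walk.mem_support_iff_exists_getVert.1 hz
  obtain ⟨i, hik, hi, hi'⟩ : ∃ i < k, p.getVert i ∈ H ∧ p.getVert (i + 1) ∉ H := by
    by_contra! h
    have : ∀ i ≤ k, p.getVert i ∈ H := fun i => by
      induction i with
      | zero => simpa using hu
      | succ i ih => exact fun hi => h i hi (ih (by omega))
    exact hzH (this k le_rfl)
  obtain ⟨j, hkj, hjl, hj, hj'⟩ : ∃ j, k ≤ j ∧ j < p.length ∧ p.getVert j ∉ H ∧
      p.getVert (j + 1) ∈ H := by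
    by_contra! h
    have : ∀ j, k ≤ j → j ≤ p.length → p.getVert j ∉ H := fun j hj => by
      induction j, hj using Nat.le_induction with
      | base => exact fun _ => hzH
      | succ j hj ih => exact fun hl => h j hj hl (ih (by omega))
    exact this _ hk le_rfl (by simpa using hv)
  have hinj := hp.getVert_injOn
  rcases hH _ hi _ hi' (p.adj_getVert_succ (by omega)) _ hj' _ hj (p.adj_getVert_succ hjl).symm with
    h | h
  · have := hinj (show i ≤ p.length by omega) (show j + 1 ≤ p.length by omega) h
    omega
  · obtain ⟨m, hm, he⟩ := p.mk_mem_edges_iff_exists.1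
      (hc.mem_edges (p.getVert_mem_support i) (p.getVert_mem_support (j + 1)) h)
    rw [Sym2.eq_iff] at he
    rcases he with ⟨h1, h2⟩ | ⟨h1, h2⟩
    · have := hinj (show m ≤ p.length by omega) (show i ≤ p.length by omega) h1
      have := hinj (show m + 1 ≤ p.length by omega) (show j + 1 ≤ p.length by omega) h2
      omega
    · have := hinj (show m ≤ p.length by omega) (show j + 1 ≤ p.length by omega) h1
      have := hinj (show m + 1 ≤ p.length by omega) (show i ≤ p.length by omega) h2
      omega

/-- Two nonadjacent boundary vertices would be joined by an induced path with interior in the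
connected complement; its second vertex contradicts the interval condition. -/
theorem CliqueBoundary.of_mInterval_subset {H : Set V}
    (hH : ∀ u ∈ H, ∀ v ∈ H, G.mInterval u v ⊆ H) (hc : (G.induce Hᶜ).Preconnected) :
    G.CliqueBoundary H := by
  intro x hx x' hx' hxx y hy y' hy' hyy
  by_contra! hne
  obtain ⟨w⟩ := hc ⟨x', hx'⟩ ⟨y', hy'⟩
  obtain ⟨w, hsupp⟩ : ∃ w : G.Walk x' y', ∀ v ∈ w.support, v ∉ H := by
    refine ⟨w.map (Embedding.induce Hᶜ).toHom, fun v hv => ?_⟩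
    obtain ⟨v, -, rfl⟩ := List.mem_map.1 ((Walk.support_map _ w) ▸ hv)
    exact v.2
  let w' : G.Walk x y := .cons hxx (w.concat hyy.symm)
  obtain ⟨p, hp, hpc, hps⟩ := w'.exists_isChordless (S := insert x (insert y Hᶜ)) <| by
    intro v hv
    simp only [w', Walk.support_cons, List.mem_cons, Walk.support_concat,
      List.mem_append, List.not_mem_nil, or_false] at hv
    rcases hv with rfl | hv | rfl
    · simp
    · exact Or.inr (Or.inr (hsupp v hv))
    · simp
  cases p with
  | nil => exact hne.1 rfl
  | @cons _ z _ hadj p =>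
    have hzs : z ∈ (Walk.cons hadj p).support := by simp
    have hz : z ∈ H := hH x hx y hy ⟨hne.1, _, hp, hpc, hzs⟩
    rcases hps z hzs with rfl | rfl | h
    · exact hadj.ne rfl
    · exact hne.2 hadj
    · exact h hz

theorem hasProperMConvexBipartition_iff_cliqueBoundary : G.HasProperMConvexBipartition ↔
    ∃ H : Set V, H.Nonempty ∧ Hᶜ.Nonempty ∧ (G.induce H).Preconnected ∧
      (G.induce Hᶜ).Preconnected ∧ G.CliqueBoundary H ∧ G.CliqueBoundary Hᶜ := by
  constructor
  · rintro ⟨A, B, hA, hB, hd, hu, hcA, hcB⟩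
    obtain rfl : B = Aᶜ := (IsCompl.of_eq hd.eq_bot hu).compl_eq.symm
    refine ⟨A, hA, hB, hcA.1, hcB.1, .of_mInterval_subset hcA.2 hcB.1,
      .of_mInterval_subset hcB.2 ?_⟩
    rw [compl_compl]
    exact hcA.1
  · rintro ⟨H, h1, h2, h3, h4, h5, h6⟩
    exact ⟨H, Hᶜ, h1, h2, disjoint_compl_right, Set.union_compl_self H,
      ⟨h3, fun u hu v hv => h5.mInterval_subset hu hv⟩,
      ⟨h4, fun u hu v hv => h6.mInterval_subset hu hv⟩⟩

theorem hasProperMConvexBipartition_iff_isMHalfspace : G.HasProperMConvexBipartition ↔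
    ∃ H : Set V, G.IsMHalfspace H ∧ ∅ ⊂ H ∧ H ⊂ Set.univ := by
  constructor
  · rintro ⟨A, B, hA, hB, hd, hu, hcA, hcB⟩
    obtain rfl : B = Aᶜ := (IsCompl.of_eq hd.eq_bot hu).compl_eq.symm
    exact ⟨A, ⟨hcA, hcB⟩, Set.empty_ssubset.2 hA,
      Set.ssubset_univ_iff.2 (Set.nonempty_compl.1 hB)⟩
  · rintro ⟨H, ⟨h1, h2⟩, h3, h4⟩
    exact ⟨H, Hᶜ, Set.empty_ssubset.1 h3, Set.nonempty_compl.2 (Set.ssubset_univ_iff.1 h4),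
      disjoint_compl_right, Set.union_compl_self H, h1, h2⟩

/-- A walk from a vertex of `H` to `b` first leaves `H` at a boundary vertex, which equals or is
adjacent to the boundary vertex `a`. -/
theorem CliqueBoundary.preconnected_induce {H : Set V} (hH : G.CliqueBoundary H)
    (hG : G.Preconnected) {a b : V} (ha : a ∈ H) (hb : b ∉ H) (hab : G.Adj a b) :
    (G.induce H).Preconnected := by
  have key : ∀ x y (_ : G.Walk x y) (hx : x ∈ H), y ∉ H →
      (G.induce H).Reachable ⟨x, hx⟩ ⟨a, ha⟩ := by
    intro x y w
    induction w with
    | nil => exact fun hx hy => absurd hx hy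
    | @cons x z y hadj w ih =>
      intro hx hy
      by_cases hz : z ∈ H
      · exact Reachable.trans (Adj.reachable (by simpa using hadj)) (ih hz hy)
      · rcases hH x hx z hz hadj a ha b hb hab with rfl | h
        · exact .refl _
        · exact Adj.reachable (by simpa using h)
  rintro ⟨x, hx⟩ ⟨y, hy⟩
  exact (key x b (hG x b).some hx hb).trans (key y b (hG y b).some hy hb).symm

theorem hasProperMConvexBipartition_iff_of_preconnected (hG : G.Preconnected) :
    G.HasProperMConvexBipartition ↔ ∃ a b, G.Adj a b ∧ ∃ H : Set V, a ∈ H ∧ b ∉ H ∧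
      G.CliqueBoundary H ∧ G.CliqueBoundary Hᶜ := by
  rw [hasProperMConvexBipartition_iff_cliqueBoundary]
  constructor
  · rintro ⟨H, ⟨x, hx⟩, ⟨y, hy⟩, -, -, h5, h6⟩
    obtain ⟨d, -, hd, hd'⟩ := (hG x y).some.exists_boundary_dart H hx hy
    exact ⟨_, _, d.adj, H, hd, hd', h5, h6⟩
  · rintro ⟨a, b, hab, H, ha, hb, h5, h6⟩
    exact ⟨H, ⟨a, ha⟩, ⟨b, hb⟩, h5.preconnected_induce hG ha hb hab,
      h6.preconnected_induce hG hb (by simpa using ha) hab.symm, h5, h6⟩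

theorem preconnected_induce_setOf_reachable (a : V) :
    (G.induce {x | G.Reachable a x}).Preconnected := by
  have key : ∀ x (hx : G.Reachable a x), (G.induce {x | G.Reachable a x}).Reachable
      ⟨a, Reachable.refl a⟩ ⟨x, hx⟩ := by
    intro x hx
    classical
    exact ⟨hx.some.induce {x | G.Reachable a x} fun y hy => ⟨hx.some.takeUntil y hy⟩⟩
  rintro ⟨x, hx⟩ ⟨y, hy⟩
  exact (key x hx).symm.trans (key y hy)

/-- Two connected halves of a disconnected graph are its two components; conversely no edge leaves a
component, so the clique conditions are vacuous. -/
theorem hasProperMConvexBipartition_iff_of_not_preconnected (hG : ¬ G.Preconnected) :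
    G.HasProperMConvexBipartition ↔
      ∃ a b, ¬ G.Reachable a b ∧ ∀ x, G.Reachable a x ∨ G.Reachable b x := by
  rw [hasProperMConvexBipartition_iff_cliqueBoundary]
  constructor
  · rintro ⟨H, ⟨a, ha⟩, ⟨b, hb⟩, h3, h4, -, -⟩
    have key : ∀ x, G.Reachable a x ∨ G.Reachable b x := by
      intro x
      by_cases hx : x ∈ H
      · exact Or.inl ((h3 ⟨a, ha⟩ ⟨x, hx⟩).map (Embedding.induce H).toHom)
      · exact Or.inr ((h4 ⟨b, hb⟩ ⟨x, hx⟩).map (Embedding.induce Hᶜ).toHom)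
    refine ⟨a, b, fun hab => hG ?_, key⟩
    have : ∀ x, G.Reachable a x := fun x => (key x).elim id hab.trans
    exact fun x y => (this x).symm.trans (this y)
  · rintro ⟨a, b, hab, h⟩
    have hc : {x | G.Reachable a x}ᶜ = {x | G.Reachable b x} := by
      ext x
      exact ⟨(h x).resolve_left, fun hb ha => hab (Reachable.trans ha (Reachable.symm hb))⟩
    refine ⟨{x | G.Reachable a x}, ⟨a, .refl a⟩, ⟨b, hab⟩,
      preconnected_induce_setOf_reachable a, ?_, ?_, ?_⟩
    · rw [hc]
      exact preconnected_induce_setOf_reachable b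
    · exact fun x hx x' hx' hadj => absurd (Reachable.trans hx hadj.reachable) hx'
    · intro x hx x' hx' hadj
      rw [Set.notMem_compl_iff] at hx'
      exact absurd (Reachable.trans hx' hadj.symm.reachable) hx

end SimpleGraph

/-! ### Separating the ends of an edge as a 2-SAT instance. -/

namespace SimpleGraph

variable {V : Type*} (G : SimpleGraph V)

/-- `u` and `w` differ and `p`, `q` are adjacent, but `p` is neither equal nor adjacent to `u`. -/
def Far (p u q w : V) : Prop := u ≠ w ∧ G.Adj p q ∧ p ≠ u ∧ ¬ G.Adj p u

/-- If `p` is on the side of `u`, then `x` lies in the boundary of the side of `s`, where `s'` is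
on the other side. -/
def Certifies (s s' x p u : V) : Prop :=
  (p = x ∧ u = s ∧ G.Adj x s') ∨
    (u = s' ∧ G.Adj x p ∧ G.Adj x s ∧ ¬ G.Adj x s' ∧ x ≠ s')

/-- `(s, s')` is `(a, b)` or `(b, a)`. -/
def OppositeSides (a b s s' : V) : Prop := (s = a ∧ s' = b) ∨ (s = b ∧ s' = a)

/-- In a separation of the adjacent vertices `a` and `b` by sets with clique boundaries, it is
impossible that both `p` is on the side of `u` and `q` on the side of `w`, where
`u, w ∈ {a, b}`. -/
def Clash (a b p u q w : V) : Prop :=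
  G.Far p u q w ∨ G.Far q w p u ∨ (p = q ∧ u = w ∧ (p = a ∨ p = b) ∧ p ≠ u) ∨
    ∃ x y s s', OppositeSides a b s s' ∧ x ≠ y ∧ ¬ G.Adj x y ∧ G.Certifies s s' x p u ∧
      G.Certifies s s' y q w

/-- The vertex `a` or `b` naming a side. -/
def side (a b : V) (s : Bool) : V := if s then a else b

/-- The implications between literals obtained from `Clash`. -/
def Implies (a b : V) (p q : V × Bool) : Prop :=
  G.Clash a b p.1 (side a b p.2) q.1 (side a b !q.2)

variable {G}

theorem Clash.symm {a b p u q w : V} (h : G.Clash a b p u q w) : G.Clash a b q w p u := by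
  rcases h with h | h | ⟨rfl, rfl, h, h'⟩ | ⟨x, y, s, s', h, hne, hadj, hx, hy⟩
  · exact Or.inr (Or.inl h)
  · exact Or.inl h
  · exact Or.inr (Or.inr (Or.inl ⟨rfl, rfl, h, h'⟩))
  · exact Or.inr (Or.inr (Or.inr ⟨y, x, s, s', h, hne.symm, fun h => hadj h.symm, hy, hx⟩))

theorem side_injective {a b : V} (hab : a ≠ b) : Function.Injective (side a b) := by
  rintro (_ | _) (_ | _) h <;> simp_all [side, eq_comm]

/-- A coloring of the vertices by `a` and `b` avoids all clashes if and only if it separates `a`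
and `b` and both color classes have clique boundaries. -/
theorem forall_not_clash_iff {a b : V} (hab : G.Adj a b) (g : V → V) (hg : ∀ x, g x = a ∨ g x = b) :
    (∀ x y, ¬ G.Clash a b x (g x) y (g y)) ↔ g a = a ∧ g b = b ∧
      ∀ x x' y y', G.Adj x x' → G.Adj y y' → g x = g y → g x' ≠ g x → g y' ≠ g y →
        x = y ∨ G.Adj x y := by
  have hne := hab.ne
  constructor
  · intro h
    have hga : g a = a := by
      by_contra hc
      exact h a a (Or.inr (Or.inr (Or.inl ⟨rfl, rfl, Or.inl rfl, fun h => hc h.symm⟩)))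
    have hgb : g b = b := by
      by_contra hc
      exact h b b (Or.inr (Or.inr (Or.inl ⟨rfl, rfl, Or.inr rfl, fun h => hc h.symm⟩)))
    refine ⟨hga, hgb, fun x x' y y' hx hy hxy hx' hy' => ?_⟩
    by_contra! hc
    -- The `Far` clauses put each boundary vertex at distance at most one from the name of its side.
    have near : ∀ x x', G.Adj x x' → g x' ≠ g x → x = g x ∨ G.Adj x (g x) := by
      intro x x' hadj hx
      by_contra! hc
      exact h x x' (Or.inl ⟨hx.symm, hadj, hc⟩)
    have hgg : ∀ x, g (g x) = g x := by
      intro x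
      rcases hg x with h | h <;> rw [h] <;> assumption
    obtain ⟨s', hs⟩ : ∃ s', OppositeSides a b (g x) s' := by
      rcases hg x with h | h <;> rw [h]
      · exact ⟨b, Or.inl ⟨rfl, rfl⟩⟩
      · exact ⟨a, Or.inr ⟨rfl, rfl⟩⟩
    have other : ∀ z, g z ≠ g x → g z = s' := by
      intro z hz
      rcases hs with ⟨h1, rfl⟩ | ⟨h1, rfl⟩ <;> rcases hg z with h2 | h2 <;> simp_all
    have hs' : g s' = s' := by rcases hs with ⟨-, rfl⟩ | ⟨-, rfl⟩ <;> assumption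
    have hss' : g x ≠ s' := by
      rcases hs with ⟨h1, rfl⟩ | ⟨h1, rfl⟩ <;> rw [h1]
      · exact hne
      · exact hne.symm
    have nx := near x x' hx hx'
    have ny := near y y' hy hy'
    rw [← hxy] at ny
    have nx' : G.Adj x (g x) := by
      rcases nx with h | h
      · rw [← h] at ny
        rcases ny with h | h
        · exact absurd h.symm hc.1
        · exact absurd h.symm hc.2
      · exact h
    have ny' : G.Adj y (g x) := by
      rcases ny with h | h
      · rw [← h] at nx'
        exact absurd nx' hc.2
      · exact h
    -- If `z` is adjacent to `s'`, its own side certifies it; otherwise the side of its neighbour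
    -- `z'` does.
    have cert : ∀ z z', G.Adj z z' → g z = g x → g z' ≠ g x → G.Adj z (g x) →
        ∃ p, G.Certifies (g x) s' z p (g p) := by
      intro z z' hz h1 h2 h3
      by_cases h4 : G.Adj z s'
      · exact ⟨z, Or.inl ⟨rfl, h1, h4⟩⟩
      · refine ⟨z', Or.inr ⟨other z' h2, hz, h3, h4, ?_⟩⟩
        rintro rfl
        exact hss' (h1.symm.trans hs')
    obtain ⟨p, hp⟩ := cert x x' hx rfl hx' nx'
    obtain ⟨q, hq⟩ := cert y y' hy hxy.symm (hxy ▸ hy') ny'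
    exact h p q (Or.inr (Or.inr (Or.inr ⟨x, y, _, _, hs, hc.1, hc.2, hp, hq⟩)))
  · rintro ⟨hga, hgb, h⟩
    have far : ∀ p q, ¬ G.Far p (g p) q (g q) := by
      rintro p q ⟨h1, h2, h3, h4⟩
      rcases hg p with hp | hp
      · have hq : g q = b := (hg q).resolve_left fun h => h1 (hp.trans h.symm)
        rcases h p q a b h2 hab (hp.trans hga.symm) h1.symm (by rw [hga, hgb]; exact hne.symm) with
          h | h
        · exact h3 (h.trans hp.symm)
        · exact h4 (hp.symm ▸ h)
      · have hq : g q = a := (hg q).resolve_right fun h => h1 (hp.trans h.symm)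
        rcases h p q b a h2 hab.symm (hp.trans hgb.symm) h1.symm (by rw [hga, hgb]; exact hne) with
          h | h
        · exact h3 (h.trans hp.symm)
        · exact h4 (hp.symm ▸ h)
    rintro p q (h1 | h1 | ⟨rfl, -, rfl | rfl, h2⟩ | ⟨x, y, s, s', hs, hxy, hadj, hx, hy⟩)
    · exact far p q h1
    · exact far q p h1
    · exact h2 hga.symm
    · exact h2 hgb.symm
    · have hss : g s = s ∧ g s' = s' ∧ G.Adj s s' ∧ ∀ z, g z = s ∨ g z = s' := by
        rcases hs with ⟨rfl, rfl⟩ | ⟨rfl, rfl⟩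
        · exact ⟨hga, hgb, hab, hg⟩
        · exact ⟨hgb, hga, hab.symm, fun z => (hg z).symm⟩
      obtain ⟨hgs, hgs', hadj', hg'⟩ := hss
      -- In the second case `z` cannot lie on the side of `s'`: its neighbour `s` would make it a
      -- boundary vertex there, though it neither equals nor is adjacent to `s'`.
      have bd : ∀ z r, G.Certifies s s' z r (g r) → g z = s ∧ ∃ z', G.Adj z z' ∧ g z' = s' := by
        rintro z r (⟨rfl, h1, h2⟩ | ⟨h1, h2, h3, h4, h5⟩)
        · exact ⟨h1, s', h2, hgs'⟩
        · refine ⟨(hg' z).resolve_right fun h6 => ?_, r, h2, h1⟩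
          rcases h z s s' s h3 hadj'.symm (h6.trans hgs'.symm) (by rw [hgs, h6]; exact hadj'.ne)
            (by rw [hgs, hgs']; exact hadj'.ne) with h | h
          · exact h5 h
          · exact h4 h
      obtain ⟨hx1, x', hx2, hx3⟩ := bd x p hx
      obtain ⟨hy1, y', hy2, hy3⟩ := bd y q hy
      rcases h x x' y y' hx2 hy2 (hx1.trans hy1.symm) (by rw [hx1, hx3]; exact hadj'.ne.symm)
        (by rw [hy1, hy3]; exact hadj'.ne.symm) with h | h
      · exact hxy h
      · exact hadj h

theorem exists_cliqueBoundary_iff_exists_not_clash {a b : V} (hab : G.Adj a b) :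
    (∃ H : Set V, a ∈ H ∧ b ∉ H ∧ G.CliqueBoundary H ∧ G.CliqueBoundary Hᶜ) ↔
      ∃ f : V → Bool, ∀ x y, ¬ G.Clash a b x (side a b (f x)) y (side a b (f y)) := by
  classical
  have hinj := side_injective hab.ne
  have hside : ∀ f : V → Bool, ∀ x, side a b (f x) = a ∨ side a b (f x) = b := by
    intro f x; cases f x <;> simp [side]
  constructor
  · rintro ⟨H, ha, hb, h1, h2⟩
    refine ⟨fun x => decide (x ∈ H), (forall_not_clash_iff hab _ (hside _)).2 ⟨?_, ?_, ?_⟩⟩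
    · simp [side, ha]
    · simp [side, hb]
    · intro x x' y y' hx hy hxy hx' hy'
      simp only [hinj.ne_iff, hinj.eq_iff, decide_eq_decide, ne_eq] at hxy hx' hy'
      by_cases hxH : x ∈ H
      · exact h1 x hxH x' (by tauto) hx y (by tauto) y' (by tauto) hy
      · exact h2 x hxH x' (by simp; tauto) hx y (by simp; tauto) y' (by simp; tauto) hy
  · rintro ⟨f, hf⟩
    rw [forall_not_clash_iff hab _ (hside _)] at hf
    obtain ⟨ha, hb, h⟩ := hf
    have ha' : f a = true := hinj (ha.trans (by simp [side]))
    have hb' : f b = false := hinj (hb.trans (by simp [side]))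
    simp only [hinj.ne_iff, hinj.eq_iff] at h
    refine ⟨{x | f x = true}, ha', by simp [hb'], ?_, ?_⟩ <;>
    · intro x hx x' hx' hxx y hy y' hy' hyy
      simp at hx hx' hy hy'
      exact h x x' y y' hxx hyy (by simp [hx, hy]) (by simp [hx, hx']) (by simp [hy, hy'])

/-- A clash of `p` with the negation of `q` is the implication from `p` to `q`; symmetry of `Clash`
is closure under contraposition. -/
theorem exists_not_clash_iff [Finite V] {a b : V} :
    (∃ f : V → Bool, ∀ x y, ¬ G.Clash a b x (side a b (f x)) y (side a b (f y))) ↔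
      ∀ x, ¬ (Relation.TransGen (G.Implies a b) (x, true) (x, false) ∧
        Relation.TransGen (G.Implies a b) (x, false) (x, true)) := by
  constructor
  · rintro ⟨f, hf⟩
    have step : ∀ p q, Relation.TransGen (G.Implies a b) p q → f p.1 = p.2 → f q.1 = q.2 := by
      have one : ∀ p q, G.Implies a b p q → f p.1 = p.2 → f q.1 = q.2 := by
        intro p q hpq hp
        by_contra hq
        replace hq : f q.1 = !q.2 := Bool.eq_not.2 hq
        have := hf p.1 q.1
        rw [hp, hq] at this
        exact this hpq
      intro p q hpq
      induction hpq with
      | single h => exact one _ _ h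
      | tail _ h ih => exact fun hp => one _ _ h (ih hp)
    rintro x ⟨h1, h2⟩
    cases hx : f x
    · simpa [hx] using step _ _ h2 hx
    · simpa [hx] using step _ _ h1 hx
  · intro h
    obtain ⟨f, hf⟩ := exists_consistent_assignment (G.Implies a b)
      (fun x s y t hI => by simpa [Implies] using hI.symm) h
    refine ⟨f, fun x y hc => ?_⟩
    simpa using hf (x, f x) (y, !f y) (by simpa [Implies] using hc) rfl

end SimpleGraph

/-! ### Reachability and entailment in a single relation. -/

theorem Relation.transGen_map_iff {α β : Type*} {r : α → α → Prop} {r' : β → β → Prop} {ι : α → β}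
    (hι : Function.Injective ι) (h : ∀ p q, r' (ι p) q ↔ ∃ p', q = ι p' ∧ r p p') (p p' : α) :
    Relation.TransGen r' (ι p) (ι p') ↔ Relation.TransGen r p p' := by
  constructor
  · suffices ∀ q, Relation.TransGen r' (ι p) q → ∃ p', q = ι p' ∧ Relation.TransGen r p p' by
      intro hT
      obtain ⟨q, hq, hT⟩ := this _ hT
      rwa [hι hq]
    intro q hT
    induction hT with
    | single h1 =>
      obtain ⟨p', rfl, hp⟩ := (h _ _).1 h1
      exact ⟨p', rfl, .single hp⟩
    | tail _ h1 ih =>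
      obtain ⟨p', rfl, hp⟩ := ih
      obtain ⟨p'', rfl, hp'⟩ := (h _ _).1 h1
      exact ⟨p'', rfl, hp.tail hp'⟩
  · exact fun hT => Relation.TransGen.lift ι (fun p p' hp => (h _ _).2 ⟨p', rfl, hp⟩) _ _ hT

namespace SimpleGraph

variable {V : Type*} (G : SimpleGraph V)

/-- The relation on pairs of vertices whose transitive closure expresses reachability (for
`a = b`) and entailment between the literals on the sides of `a` and `b` (for `a ≠ b`). -/
def Entails (a b : V) (p q : V × V) : Prop :=
  (a = b ∧ p.2 = a ∧ q.2 = a ∧ (p.1 = q.1 ∨ G.Adj p.1 q.1)) ∨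
    (a ≠ b ∧ (p.2 = a ∨ p.2 = b) ∧ ∃ t, OppositeSides a b q.2 t ∧ G.Clash a b p.1 p.2 q.1 t)

variable {G}

/-- The diagonal `a = b` is free to carry reachability; the disjunct `p.1 = q.1` makes the
transitive closure reflexive there. -/
theorem transGen_entails_self (a x y : V) :
    Relation.TransGen (G.Entails a a) (x, a) (y, a) ↔ G.Reachable x y := by
  rw [Relation.transGen_map_iff (ι := fun x => (x, a)) (r := fun x y => x = y ∨ G.Adj x y)
    (fun x y h => congrArg Prod.fst h)]
  · constructor
    · intro h
      induction h with
      | single h => exact h.elim (fun h => h ▸ .refl _) Adj.reachable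
      | tail _ h ih => exact ih.trans (h.elim (fun h => h ▸ .refl _) Adj.reachable)
    · intro h
      refine .head' (Or.inl rfl) ?_
      rw [reachable_iff_reflTransGen] at h
      exact Relation.ReflTransGen.mono (fun _ _ => Or.inr) _ _ h
  · rintro x ⟨y, t⟩
    simp [Entails]

theorem transGen_entails_side {a b : V} (hab : a ≠ b) (p q : V × Bool) :
    Relation.TransGen (G.Entails a b) (p.1, side a b p.2) (q.1, side a b q.2) ↔
      Relation.TransGen (G.Implies a b) p q := by
  have hinj := side_injective hab
  rw [← Relation.transGen_map_iff (ι := fun p : V × Bool => (p.1, side a b p.2))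
    (r := G.Implies a b) (r' := G.Entails a b)]
  · rintro ⟨x, s⟩ ⟨y, t⟩ h
    simp only [Prod.mk.injEq] at h
    exact Prod.ext h.1 (hinj h.2)
  · rintro ⟨x, s⟩ ⟨y, t⟩
    have hs : side a b s = a ∨ side a b s = b := by cases s <;> simp [side]
    simp only [Entails, Implies, Prod.exists, Bool.exists_bool, hab, hs, Prod.mk.injEq, OppositeSides]
    constructor
    · rintro (⟨h, -⟩ | ⟨-, -, t', ⟨rfl, rfl⟩ | ⟨rfl, rfl⟩, h⟩)
      · exact h.elim
      · exact ⟨y, Or.inr ⟨⟨rfl, rfl⟩, by simpa [side] using h⟩⟩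
      · exact ⟨y, Or.inl ⟨⟨rfl, rfl⟩, by simpa [side] using h⟩⟩
    · rintro ⟨_, ⟨⟨rfl, rfl⟩, h⟩ | ⟨⟨rfl, rfl⟩, h⟩⟩
      · exact Or.inr ⟨hab, trivial, a, Or.inr ⟨rfl, rfl⟩, by simpa [side] using h⟩
      · exact Or.inr ⟨hab, trivial, b, Or.inl ⟨rfl, rfl⟩, by simpa [side] using h⟩

/-- The existence of a proper partition into two m-convex sets in terms of `Entails`. -/
theorem hasProperMConvexBipartition_iff_entails [Finite V] : G.HasProperMConvexBipartition ↔
    ((∀ x y, Relation.TransGen (G.Entails x x) (x, x) (y, x)) ∧ ∃ a b, G.Adj a b ∧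
      ¬ ∃ x, Relation.TransGen (G.Entails a b) (x, a) (x, b) ∧
        Relation.TransGen (G.Entails a b) (x, b) (x, a)) ∨
    ∃ a b, ¬ Relation.TransGen (G.Entails a a) (a, a) (b, a) ∧
      ∀ x, Relation.TransGen (G.Entails a a) (a, a) (x, a) ∨
        Relation.TransGen (G.Entails b b) (b, b) (x, b) := by
  simp only [transGen_entails_self]
  by_cases hG : G.Preconnected
  · have h1 : (∀ x y, G.Reachable x y) := hG
    simp only [hasProperMConvexBipartition_iff_of_preconnected hG, h1, implies_true, true_and,
      not_true_eq_false, false_and, exists_false, or_false]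
    refine exists_congr fun a => exists_congr fun b => and_congr_right fun hab => ?_
    rw [exists_cliqueBoundary_iff_exists_not_clash hab, exists_not_clash_iff, not_exists]
    refine forall_congr' fun x => ?_
    rw [← transGen_entails_side hab.ne, ← transGen_entails_side hab.ne]
    rfl
  · have h1 : ¬ (∀ x y, G.Reachable x y) := hG
    simp only [hasProperMConvexBipartition_iff_of_not_preconnected hG, h1, false_and, false_or]

end SimpleGraph

/-! ### The criterion as a first-order formula over a fixed point. -/

namespace RAM.Formula

open SimpleGraph

variable {n d : ℕ} {A : ℕ → ℕ → ℕ} {e : Fin d → Fin n}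

/-- Disjunction. -/
def or (φ ψ : Formula d) : Formula d := not (and (not φ) (not ψ))

@[simp] theorem eval_or {φ ψ : Formula d} : (or φ ψ).Eval A e ↔ φ.Eval A e ∨ ψ.Eval A e := by
  simp [or, Eval]; tauto

@[simp] theorem eval_and {φ ψ : Formula d} : (and φ ψ).Eval A e ↔ φ.Eval A e ∧ ψ.Eval A e :=
  Iff.rfl

@[simp] theorem eval_not {φ : Formula d} : (not φ).Eval A e ↔ ¬ φ.Eval A e := Iff.rfl

@[simp] theorem eval_eq {i j : Fin d} : (eq i j).Eval A e ↔ e i = e j := Iff.rfl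

@[simp] theorem eval_ex {φ : Formula (d + 1)} :
    (ex φ).Eval A e ↔ ∃ v, φ.Eval A (Matrix.vecCons v e) := Iff.rfl

/-- Adjacency. -/
def adj (i j : Fin d) : Formula d := rel 0 [i, j]

/-- The formula for `SimpleGraph.Far`. -/
def far (p u q w : Fin d) : Formula d :=
  and (not (eq u w)) (and (adj p q) (and (not (eq p u)) (not (adj p u))))

/-- The formula for `SimpleGraph.Certifies`. -/
def certifies (s s' x p u : Fin d) : Formula d :=
  or (and (eq p x) (and (eq u s) (adj x s')))
    (and (eq u s') (and (adj x p) (and (adj x s) (and (not (adj x s')) (not (eq x s'))))))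

/-- The formula for `SimpleGraph.OppositeSides`. -/
def opposite (a b s s' : Fin d) : Formula d :=
  or (and (eq s a) (eq s' b)) (and (eq s b) (eq s' a))

/-- The formula for `SimpleGraph.Clash`. -/
def clash (a b p u q w : Fin d) : Formula d :=
  let up : Fin d → Fin (d + 4) := fun i => i.succ.succ.succ.succ
  or (far p u q w) <| or (far q w p u) <|
    or (and (eq p q) (and (eq u w) (and (or (eq p a) (eq p b)) (not (eq p u))))) <|
    ex <| ex <| ex <| ex <| and (opposite (up a) (up b) 1 0) <| and (not (eq 3 2)) <|
      and (not (adj 3 2)) <| and (certifies 1 0 3 (up p) (up u)) (certifies 1 0 2 (up q) (up w))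

/-- The formula for `SimpleGraph.Entails`. -/
def entails (a b x s y t : Fin d) : Formula d :=
  or (and (eq a b) (and (eq s a) (and (eq t a) (or (eq x y) (adj x y)))))
    (and (not (eq a b)) (and (or (eq s a) (eq s b))
      (ex (and (opposite a.succ b.succ t.succ 0) (clash a.succ b.succ x.succ s.succ y.succ 0)))))

/-- The operator whose least fixed point is the transitive closure of `SimpleGraph.Entails`. -/
def entailsOp : Formula 6 :=
  -- Under the two quantifiers the outer indices shift by two, and `1`, `0` denote the intermediate
  -- literal.
  or (entails 0 1 2 3 4 5) (ex (ex (and (rel 1 [2, 3, 4, 5, 1, 0]) (rel 1 [2, 3, 1, 0, 6, 7]))))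

/-- The sentence for `SimpleGraph.hasProperMConvexBipartition_iff_entails`. -/
def bipartition : Formula 0 :=
  or (and (not (ex (ex (not (rel 1 [1, 1, 1, 1, 0, 1])))))
      (ex (ex (and (adj 1 0) (not (ex (and (rel 1 [2, 1, 0, 2, 0, 1])
        (rel 1 [2, 1, 0, 1, 0, 2]))))))))
    (ex (ex (and (not (rel 1 [1, 1, 1, 1, 0, 1]))
      (not (ex (and (not (rel 1 [2, 2, 2, 2, 0, 2])) (not (rel 1 [1, 1, 1, 1, 0, 1]))))))))

variable {G : SimpleGraph (Fin n)}

theorem eval_adj (hA : A 0 = (graphInput G).arr 0) {i j : Fin d} :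
    (adj i j).Eval A e ↔ G.Adj (e i) (e j) := by
  simp only [adj, Eval, hA, graphInput, encode]
  constructor
  · intro h
    simp at h
    obtain ⟨u, v, huv, h⟩ := h
    have := @encode_ofFn_injective n 2 ![e i, e j] ![u, v] (by simpa [encode] using h)
    have h1 := congrFun this 0
    have h2 := congrFun this 1
    simp at h1 h2
    rwa [h1, h2]
  · intro h
    simp
    exact ⟨_, _, h, rfl⟩

theorem eval_far (hA : A 0 = (graphInput G).arr 0) {p u q w : Fin d} :
    (far p u q w).Eval A e ↔ G.Far (e p) (e u) (e q) (e w) := by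
  simp [far, Far, eval_adj hA]

theorem eval_certifies (hA : A 0 = (graphInput G).arr 0) {s s' x p u : Fin d} :
    (certifies s s' x p u).Eval A e ↔ G.Certifies (e s) (e s') (e x) (e p) (e u) := by
  simp [certifies, Certifies, eval_adj hA]

theorem eval_opposite {a b s s' : Fin d} :
    (opposite a b s s').Eval A e ↔ OppositeSides (e a) (e b) (e s) (e s') := by
  simp [opposite, OppositeSides]

theorem eval_clash (hA : A 0 = (graphInput G).arr 0) {a b p u q w : Fin d} :
    (clash a b p u q w).Eval A e ↔ G.Clash (e a) (e b) (e p) (e u) (e q) (e w) := by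
  simp only [clash, Clash, eval_or, eval_and, eval_not, eval_eq, eval_ex, eval_far hA,
    eval_certifies hA, eval_opposite, eval_adj hA]
  rfl

theorem eval_entails (hA : A 0 = (graphInput G).arr 0) {a b x s y t : Fin d} :
    (entails a b x s y t).Eval A e ↔ G.Entails (e a) (e b) (e x, e s) (e y, e t) := by
  simp only [entails, Entails, eval_or, eval_and, eval_not, eval_eq, eval_ex, eval_clash hA,
    eval_opposite, eval_adj hA]
  rfl

theorem eval_rel_six {a : ℕ} {i₀ i₁ i₂ i₃ i₄ i₅ : Fin d} :
    (rel a [i₀, i₁, i₂, i₃, i₄, i₅]).Eval A e ↔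
      ![e i₀, e i₁, e i₂, e i₃, e i₄, e i₅] ∈ tuples n 6 (A a) := by
  simp [Eval, tuples, List.ofFn_succ]

theorem eval_entailsOp (hA : A 0 = (graphInput G).arr 0) {e : Fin 6 → Fin n} :
    entailsOp.Eval A e ↔ G.Entails (e 0) (e 1) (e 2, e 3) (e 4, e 5) ∨
      ∃ z u, ![e 0, e 1, e 2, e 3, z, u] ∈ tuples n 6 (A 1) ∧
        ![e 0, e 1, z, u, e 4, e 5] ∈ tuples n 6 (A 1) := by
  simp only [entailsOp, eval_or, eval_and, eval_ex, eval_entails hA, eval_rel_six]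
  rfl

/-- Closure under the operator yields every chain; leastness gives the converse, since transitivity
of `TransGen` makes its set of tuples closed. -/
theorem mem_tuples_iff_transGen (hA : A 0 = (graphInput G).arr 0)
    (h1 : ∀ e : Fin 6 → Fin n, entailsOp.Eval A e → e ∈ tuples n 6 (A 1))
    (h2 : ∀ L : Set (Fin 6 → Fin n), ClosedUnder 1 entailsOp A L → tuples n 6 (A 1) ⊆ L)
    (a b x s y t : Fin n) : ![a, b, x, s, y, t] ∈ tuples n 6 (A 1) ↔
      Relation.TransGen (G.Entails a b) (x, s) (y, t) := by
  constructor
  · refine fun h => h2 {e | Relation.TransGen (G.Entails (e 0) (e 1)) (e 2, e 3) (e 4, e 5)} ?_ h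
    intro A' hA' hsub e he
    rw [eval_entailsOp ((hA' 0 zero_ne_one).trans hA)] at he
    rcases he with he | ⟨z, u, hz, hz'⟩
    · exact .single he
    · have k₁ : Relation.TransGen (G.Entails (e 0) (e 1)) (e 2, e 3) (z, u) := @hsub _ hz
      have k₂ : Relation.TransGen (G.Entails (e 0) (e 1)) (z, u) (e 4, e 5) := @hsub _ hz'
      exact k₁.trans k₂
  · suffices ∀ q, Relation.TransGen (G.Entails a b) (x, s) q →
        ![a, b, x, s, q.1, q.2] ∈ tuples n 6 (A 1) from this (y, t)
    intro q h
    induction h with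
    | single h => exact h1 _ ((eval_entailsOp hA).2 (Or.inl h))
    | tail _ h ih =>
      exact h1 _ ((eval_entailsOp hA).2
        (Or.inr ⟨_, _, ih, h1 _ ((eval_entailsOp hA).2 (Or.inl h))⟩))

theorem eval_bipartition (hA : A 0 = (graphInput G).arr 0)
    (h1 : ∀ e : Fin 6 → Fin n, entailsOp.Eval A e → e ∈ tuples n 6 (A 1))
    (h2 : ∀ L : Set (Fin 6 → Fin n), ClosedUnder 1 entailsOp A L → tuples n 6 (A 1) ⊆ L)
    (e₀ : Fin 0 → Fin n) : bipartition.Eval A e₀ ↔ G.HasProperMConvexBipartition := by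
  simp only [bipartition, eval_or, eval_and, eval_not, eval_ex, eval_rel_six, eval_adj hA,
    mem_tuples_iff_transGen hA h1 h2, hasProperMConvexBipartition_iff_entails, not_exists,
    not_and_or, not_not]
  rfl

end RAM.Formula

theorem mainTheorem12 :
    RAM.DecidableInPolyTime (fun {_} G => G.HasProperMConvexBipartition) ∧
      ∀ (n : ℕ) (G : SimpleGraph (Fin n)), G.HasProperMConvexBipartition ↔
        ∃ H : Set (Fin n), G.IsMHalfspace H ∧ ∅ ⊂ H ∧ H ⊂ Set.univ :=
  ⟨.of_fixedPoint RAM.Formula.entailsOp RAM.Formula.bipartition fun _ _ _ e₀ hA h1 h2 =>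
    RAM.Formula.eval_bipartition hA h1 h2 e₀,
  fun _ _ => SimpleGraph.hasProperMConvexBipartition_iff_isMHalfspace⟩
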